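/- Let $T=(t_s)_{s\in\mathbb{Z}}$ be i.i.d. random variables with uniform distribution on $[0,1]$, and let $\mathbb{P}$ be the corresponding product measure on $[0,1]^{\mathbb{Z}}$. In the random sequential adsorption process on $\mathbb{Z}$ with nearest-neighbour exclusion, all sites are initially vacant and each site $s$ becomes (and then stays) occupied at time $t_s$ if both $s-1$ and $s+1$ are vacant at that time. That is, the state $\omega_s(t)=\omega_s(T,t)\in\{0,1\}$ of the site $s$ at time $t$ is given by $$\omega_s(T,t)=1 \iff t_s\le t,\ \ \omega_{s-1}(T,t_s)=0\ \text{ and }\ \omega_{s+1}(T,t_s)=0 \qquad (s\in\mathbb{Z},\ t\in[0,1]).$$ For $\mathbb{P}$-almost every $T$ this recursion has exactly one solution $(\omega_s(T,t))_{s\in\mathbb{Z},\,t\in[0,1]}$. Moreover, for every $t\in[0,1]$ and every even integer $s\ge 0$, the event $\{\omega_{-1}(t)=\omega_0(t)=0,\ \omega_s(t)=1\}$ is measurable up to a $\mathbb{P}$-null set and $$\gamma_s(t):=\mathbb{P}\bigl(\omega_{-1}(t)=\omega_0(t)=0,\ \omega_s(t)=1\bigr)=-\tfrac12\, e^{-2t}\sum_{i=1}^{s}\frac{(-2t)^i}{i!}.$$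 -/

import Mathlib

open MeasureTheory

namespace RSA

/-- The evolution of a configuration: `ω t s` is the state of the site `s` at time `t`
(`1` is occupied, `0` is vacant). -/
abbrev Evolution : Type := unitInterval → ℤ → Fin 2

/-- `ω` is a random sequential adsorption process with nearest-neighbour exclusion on `ℤ`, driven
by the arrival times `T`: the state of `s` at time `t` is the product of the indicators of
`T s ≤ t`, of `s - 1` being vacant at time `T s`, and of `s + 1` being vacant at time `T s`. -/
def IsEvolution (T : ℤ → unitInterval) (ω : Evolution) : Prop :=
  ∀ t s, ω t s = 1 ↔ T s ≤ t ∧ ω (T s) (s - 1) = 0 ∧ ω (T s) (s + 1) = 0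

open Classical in
/-- The process `ω(T, ·)` driven by the arrival times `T`. For the exceptional `T` for which the
defining recursion does not have exactly one solution, all sites are declared vacant. -/
noncomputable def omega (T : ℤ → unitInterval) : Evolution :=
  if h : ∃! ω : Evolution, IsEvolution T ω then h.choose else fun _ _ => 0

/-- The law of a family, indexed by `ℤ`, of independent arrival times that are uniform
on `[0,1]`. -/
noncomputable def P : Measure (ℤ → unitInterval) :=
  Measure.infinitePi fun _ => (volume : Measure unitInterval)

/-- The event that at time `t` the sites `-1` and `0` are vacant and the site `s` is occupied. -/
def D (s : ℤ) (t : unitInterval) : Set (ℤ → unitInterval) :=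
  {T | omega T t (-1) = 0 ∧ omega T t 0 = 0 ∧ omega T t s = 1}

/-- The probability of the event `D s t`. -/
noncomputable def gamma (s : ℤ) (t : unitInterval) : ℝ := P.real (D s t)

end RSA

/-!
Almost surely no arrival times coincide, and along every half-line some site arrives after the first
one. The state of the end site of a half-line is then decided by finitely many sites, and the
evolution is determined: a site is occupied exactly when it is the occupied end site of the
processes on the two half-lines that start there.

A pair of vacant neighbours shields its two sides from each other. Hence `D s t` is, up to a null
set, the intersection of two independent events: in the process on `…, -2, -1` the end site is
vacant, and in the process on `0, 1, …` the end site is vacant while `s` is occupied.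

The state of an end site is fixed at its arrival by the process on the remaining sites. Conditioning
on its arrival time therefore expresses the probabilities for an interval, or for a half-line with a
marked site, as integrals of those for an interval with one site fewer. Partial sums of the
exponential series solve these recursions.
-/

namespace RSA

open Filter Topology

section OneSided

variable {α : Type*} [LinearOrder α] {x y : ℕ → α} {t u : α} {m n : ℕ}

/-- The process on the sites `0, …, n` with arrival times `x`: the end site `0` is occupied at
time `t`. -/
def EndOccupiedUpTo : ℕ → (ℕ → α) → α → Prop
  | 0, x, t => x 0 ≤ t
  | n + 1, x, t => x 0 ≤ t ∧ ¬ EndOccupiedUpTo n (fun i => x (i + 1)) (x 0)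

/-- The process on the half-line `0, 1, 2, …` with arrival times `x`, understood as the limit of
the processes on `0, …, n`: the end site `0` is occupied at time `t`. -/
def EndOccupied (x : ℕ → α) (t : α) : Prop :=
  ∀ᶠ n in atTop, EndOccupiedUpTo n x t

lemma endOccupiedUpTo_iff : EndOccupiedUpTo n x t ↔ x 0 ≤ t ∧ EndOccupiedUpTo n x (x 0) := by
  cases n <;> simp [EndOccupiedUpTo]

lemma endOccupiedUpTo_congr (h : ∀ i ≤ n, x i = y i) :
    EndOccupiedUpTo n x t ↔ EndOccupiedUpTo n y t := by
  induction n generalizing x y t with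
  | zero => simp only [EndOccupiedUpTo, h 0 le_rfl]
  | succ n ih =>
    simp only [EndOccupiedUpTo, h 0 (Nat.zero_le _)]
    rw [ih fun i hi => h (i + 1) (Nat.succ_le_succ hi)]

lemma endOccupiedUpTo_iff_of_lt (h : x 0 < x (n + 1)) (hnm : n ≤ m) :
    EndOccupiedUpTo m x t ↔ EndOccupiedUpTo n x t := by
  induction n generalizing x t m with
  | zero =>
    cases m with
    | zero => rfl
    | succ m =>
      have hx : ¬ EndOccupiedUpTo m (fun i => x (i + 1)) (x 0) := fun hm =>
        h.not_ge (endOccupiedUpTo_iff.1 hm).1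
      simp only [EndOccupiedUpTo, hx, not_false_eq_true, and_true]
  | succ n ih =>
    obtain ⟨m, rfl⟩ := Nat.exists_eq_add_of_le' (Nat.one_le_of_lt hnm)
    refine and_congr_right fun _ => not_congr ?_
    by_cases hx : x 1 ≤ x 0
    · exact ih (hx.trans_lt h) (Nat.le_of_succ_le_succ hnm)
    · rw [endOccupiedUpTo_iff, endOccupiedUpTo_iff (n := n)]
      simp only [zero_add, hx, false_and]

lemma eventually_endOccupiedUpTo_iff (h : ∃ n, x 0 < x (n + 1)) (t : α) :
    ∀ᶠ n in atTop, EndOccupiedUpTo n x t ↔ EndOccupied x t := by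
  obtain ⟨n, hn⟩ := h
  have hconst : ∀ᶠ m in atTop, EndOccupiedUpTo m x t ↔ EndOccupiedUpTo n x t :=
    (eventually_ge_atTop n).mono fun m hm => endOccupiedUpTo_iff_of_lt hn hm
  rw [EndOccupied, eventually_congr hconst, eventually_const]
  exact hconst

lemma endOccupied_iff_upTo_of_lt (h : x 0 < x (n + 1)) :
    EndOccupied x t ↔ EndOccupiedUpTo n x t := by
  obtain ⟨m, hm, hnm⟩ :=
    ((eventually_endOccupiedUpTo_iff ⟨n, h⟩ t).and (eventually_ge_atTop n)).exists
  rw [← hm, endOccupiedUpTo_iff_of_lt h hnm]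

lemma endOccupied_iff : EndOccupied x t ↔ x 0 ≤ t ∧ EndOccupied x (x 0) := by
  simp only [EndOccupied, endOccupiedUpTo_iff (t := t), eventually_and, eventually_const]

lemma EndOccupied.arrival_le (h : EndOccupied x t) : x 0 ≤ t := (endOccupied_iff.1 h).1

lemma endOccupiedUpTo_succ_iff_of_ne (h : x 0 ≠ x (n + 1)) :
    EndOccupiedUpTo (n + 1) x (x (n + 1)) ↔ EndOccupiedUpTo n x (x (n + 1)) := by
  rcases h.lt_or_gt with hlt | hgt
  · exact endOccupiedUpTo_iff_of_lt hlt (Nat.le_succ n)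
  · rw [endOccupiedUpTo_iff, endOccupiedUpTo_iff (n := n)]
    simp only [hgt.not_ge, false_and]

lemma endOccupied_iff_upTo_of_ne (h : x 0 ≠ x (n + 1)) :
    EndOccupied x (x (n + 1)) ↔ EndOccupiedUpTo n x (x (n + 1)) := by
  rcases h.lt_or_gt with hlt | hgt
  · exact endOccupied_iff_upTo_of_lt hlt
  · rw [endOccupied_iff, endOccupiedUpTo_iff (n := n)]
    simp only [hgt.not_ge, false_and]

lemma EndOccupied.mono (htu : t ≤ u) (h : EndOccupied x t) : EndOccupied x u :=
  endOccupied_iff.2 ⟨h.arrival_le.trans htu, (endOccupied_iff.1 h).2⟩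

lemma endOccupied_iff_of_lt (h : x 0 < x 1) : EndOccupied x t ↔ x 0 ≤ t :=
  endOccupied_iff_upTo_of_lt (n := 0) h

lemma endOccupied_iff_not_endOccupied_shift (h : ∃ n, x 0 < x (n + 1)) :
    EndOccupied x t ↔ x 0 ≤ t ∧ ¬ EndOccupied (fun i => x (i + 1)) (x 0) := by
  by_cases hx : x 0 < x 1
  · have hvacant : ¬ EndOccupied (fun i => x (i + 1)) (x 0) := fun h1 => h1.arrival_le.not_gt hx
    simp only [endOccupied_iff_of_lt hx, hvacant, not_false_eq_true, and_true]
  · obtain ⟨_ | n, hn⟩ := h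
    · exact absurd hn hx
    · rw [endOccupied_iff_upTo_of_lt hn,
        endOccupied_iff_upTo_of_lt (n := n) ((not_lt.1 hx).trans_lt hn)]
      rfl

lemma endOccupied_iff_upTo_of_not_endOccupied (hx : ∀ k, ∃ n, x k < x (k + n + 1))
    (h : ¬ EndOccupied (fun i => x (n + 1 + i)) t) :
    EndOccupied x t ↔ EndOccupiedUpTo n x t := by
  induction n generalizing x t with
  | zero =>
    rw [endOccupied_iff_not_endOccupied_shift (by simpa using hx 0), EndOccupiedUpTo]
    refine and_iff_left_of_imp fun h0 h1 => h ?_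
    simpa only [zero_add, add_comm] using h1.mono h0
  | succ n ih =>
    rw [endOccupied_iff_not_endOccupied_shift (by simpa using hx 0), EndOccupiedUpTo]
    refine and_congr_right fun h0 => not_congr (ih (fun k => ?_) fun h1 => h ?_)
    · simpa only [add_right_comm _ _ 1] using hx (k + 1)
    · simpa only [add_right_comm _ _ 1] using h1.mono h0

end OneSided

section Rays

variable {α : Type*} {T : ℤ → α} {t : α} {d s : ℤ} {n : ℕ}

/-- The arrival times of the sites `s, s + d, s + 2 * d, …`. -/
def ray (d : ℤ) (T : ℤ → α) (s : ℤ) : ℕ → α := fun i => T (s + i * d)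

@[simp]
lemma ray_apply_zero : ray d T s 0 = T s := by simp [ray]

lemma ray_add_apply (k i : ℕ) : ray d T s (k + i) = ray d T (s + k * d) i := by
  simp only [ray]
  congr 1
  push_cast
  ring

lemma ray_succ_apply (i : ℕ) : ray d T s (i + 1) = ray d T (s + d) i := by
  rw [add_comm, ray_add_apply, Nat.cast_one, one_mul]

variable [LinearOrder α]

lemma endOccupiedUpTo_ray_succ :
    EndOccupiedUpTo (n + 1) (ray d T s) t ↔
      T s ≤ t ∧ ¬ EndOccupiedUpTo n (ray d T (s + d)) (T s) := by
  simp only [EndOccupiedUpTo, ray_apply_zero, ray_succ_apply]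

/-- Arrival times without ties, such that along every progression some site arrives after the
first one: these almost sure properties make the process well defined. -/
structure Regular (T : ℤ → α) : Prop where
  injective : Function.Injective T
  exists_lt : ∀ d ≠ 0, ∀ s, ∃ n, T s < ray d T s (n + 1)

lemma Regular.ne (hT : Regular T) {r s : ℤ} (h : r ≠ s) : T r ≠ T s := hT.injective.ne h

lemma Regular.endOccupied_ray_iff (hT : Regular T) (hd : d ≠ 0) :
    EndOccupied (ray d T s) t ↔ T s ≤ t ∧ ¬ EndOccupied (ray d T (s + d)) (T s) := by
  rw [endOccupied_iff_not_endOccupied_shift (by simpa using hT.exists_lt d hd s)]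
  simp only [ray_apply_zero, ray_succ_apply]

lemma endOccupied_ray_iff_of_lt (h : T s < T (s + d)) : EndOccupied (ray d T s) t ↔ T s ≤ t := by
  simpa using endOccupied_iff_of_lt (x := ray d T s) (t := t) (by simpa [ray] using h)

lemma Regular.endOccupied_ray_iff_upTo (hT : Regular T) (hd : d ≠ 0)
    (h : ¬ EndOccupied (ray d T (s + (n + 1) * d)) t) :
    EndOccupied (ray d T s) t ↔ EndOccupiedUpTo n (ray d T s) t := by
  refine endOccupied_iff_upTo_of_not_endOccupied (fun k => ?_) ?_
  · obtain ⟨m, hm⟩ := hT.exists_lt d hd (s + k * d)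
    exact ⟨m, by rwa [add_assoc k, ray_add_apply k]⟩
  · simpa only [ray_add_apply, Nat.cast_succ] using h

end Rays

section Evolution

variable {T : ℤ → unitInterval} {ω : Evolution} {t : unitInterval} {d s : ℤ}

lemma IsEvolution.arrival_le (hω : IsEvolution T ω) (h : ω t s = 1) : T s ≤ t := ((hω t s).1 h).1

lemma ne_one_iff_eq_zero {a : Fin 2} : a ≠ 1 ↔ a = 0 := by omega

lemma IsEvolution.eq_one_iff (hω : IsEvolution T ω) (hd : d = 1 ∨ d = -1) :
    ω t s = 1 ↔ T s ≤ t ∧ ω (T s) (s + d) ≠ 1 ∧ ω (T s) (s - d) ≠ 1 := by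
  rw [hω t s, ne_one_iff_eq_zero, ne_one_iff_eq_zero]
  rcases hd with rfl | rfl
  · rw [and_comm (a := ω (T s) (s - 1) = 0)]
  · rw [sub_neg_eq_add, ← sub_eq_add_neg]

/-- The site `s` does not influence its neighbour `s + d` before its own arrival. -/
lemma IsEvolution.neighbour_eq_one_iff (hω : IsEvolution T ω) (hT : Regular T)
    (hd : d = 1 ∨ d = -1) (s : ℤ) :
    ω (T s) (s + d) = 1 ↔ EndOccupied (ray d T (s + d)) (T s) := by
  have hd0 : d ≠ 0 := by omega
  obtain ⟨n, hn⟩ := hT.exists_lt d hd0 s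
  induction n generalizing s with
  | zero =>
    have h : T s < T (s + d) := by simpa [ray] using hn
    exact iff_of_false (fun h1 => h.not_ge (hω.arrival_le h1))
      fun h1 => h.not_ge (by simpa using h1.arrival_le)
  | succ n ih =>
    rw [hω.eq_one_iff hd, hT.endOccupied_ray_iff hd0, add_sub_cancel_right]
    refine and_congr_right fun hle => ?_
    have hlt : T (s + d) < T s := hle.lt_of_ne (hT.ne (by omega))
    have hs : ω (T (s + d)) s ≠ 1 := fun h1 => hlt.not_ge (hω.arrival_le h1)
    rw [and_iff_left hs]
    exact not_congr (ih (s + d) (hlt.trans (by rwa [← ray_succ_apply])))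

lemma IsEvolution.eq_one_iff_endOccupied (hω : IsEvolution T ω) (hT : Regular T) :
    ω t s = 1 ↔ EndOccupied (ray 1 T s) t ∧ EndOccupied (ray (-1) T s) t := by
  rw [hω.eq_one_iff (.inl rfl), sub_eq_add_neg, ne_eq, ne_eq,
    hω.neighbour_eq_one_iff hT (.inl rfl), hω.neighbour_eq_one_iff hT (.inr rfl),
    hT.endOccupied_ray_iff (s := s) one_ne_zero,
    hT.endOccupied_ray_iff (s := s) (neg_ne_zero.2 one_ne_zero)]
  tauto

lemma Regular.endOccupied_ray_both_iff (hT : Regular T) (hd : d ≠ 0) :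
    EndOccupied (ray d T (s + d)) (T s) ∧ EndOccupied (ray (-d) T (s + d)) (T s) ↔
      EndOccupied (ray d T (s + d)) (T s) := by
  refine and_iff_left_of_imp fun h => ?_
  have hle : T (s + d) ≤ T s := by simpa using h.arrival_le
  have hlt : T (s + d) < T (s + d + -d) := by
    simpa using hle.lt_of_ne (hT.ne (by omega))
  exact (endOccupied_ray_iff_of_lt hlt).2 hle

open Classical in
lemma Regular.isEvolution (hT : Regular T) :
    IsEvolution T fun t s =>
      if EndOccupied (ray 1 T s) t ∧ EndOccupied (ray (-1) T s) t then 1 else 0 := by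
  intro t s
  have hright := hT.endOccupied_ray_both_iff (s := s) one_ne_zero
  have hleft := hT.endOccupied_ray_both_iff (s := s) (neg_ne_zero.2 (one_ne_zero (α := ℤ)))
  rw [neg_neg, and_comm] at hleft
  simp only [ite_eq_left_iff, ite_eq_right_iff, zero_ne_one, one_ne_zero, imp_false, not_not,
    sub_eq_add_neg, hright, hleft]
  rw [hT.endOccupied_ray_iff one_ne_zero, hT.endOccupied_ray_iff (neg_ne_zero.2 one_ne_zero)]
  tauto

lemma Regular.existsUnique_isEvolution (hT : Regular T) : ∃! ω : Evolution, IsEvolution T ω := by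
  refine ⟨_, hT.isEvolution, fun ω hω => ?_⟩
  funext t s
  have h : ω t s = 1 ↔ _ :=
    (hω.eq_one_iff_endOccupied hT).trans (hT.isEvolution.eq_one_iff_endOccupied hT).symm
  omega

lemma Regular.omega_eq_one_iff (hT : Regular T) :
    omega T t s = 1 ↔ EndOccupied (ray 1 T s) t ∧ EndOccupied (ray (-1) T s) t := by
  have hω : IsEvolution T (omega T) := by
    rw [omega, dif_pos hT.existsUnique_isEvolution]
    exact hT.existsUnique_isEvolution.choose_spec.1
  exact hω.eq_one_iff_endOccupied hT

end Evolution

section FirstArrival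

variable {α : Type*} [LinearOrder α] {L R : α → Prop} {l r t : α}

-- `L` and `R` say that two sites, arriving at the times `l` and `r`, are occupied: each of
-- them is occupied from its arrival on or never.
lemma or_iff_or_at_arrival (hL : ∀ t, L t ↔ l ≤ t ∧ L l) (hR : ∀ t, R t ↔ r ≤ t ∧ R r)
    (h : l ≠ r) : L t ∨ R t ↔ L t ∧ ¬ R l ∨ R t ∧ ¬ L r := by
  grind

lemma not_and_at_arrival (hL : ∀ t, L t ↔ l ≤ t ∧ L l) (hR : ∀ t, R t ↔ r ≤ t ∧ R r) :
    ¬ ((L t ∧ ¬ R l) ∧ R t ∧ ¬ L r) := by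
  grind

lemma and_not_at_arrival_iff (hL : ∀ t, L t ↔ l ≤ t ∧ L l) (hR : ∀ t, R t ↔ r ≤ t ∧ R r)
    (h : l ≠ r) : R t ∧ ¬ L r ↔ ¬ L t ∧ R t ∨ L t ∧ R l := by
  grind

end FirstArrival

/-- The site `r` has arrived by time `t`, and the time-dependent event `E` holds at its arrival
time. -/
def OnArrival {ι α : Type*} [LE α] (r : ι) (E : α → (ι → α) → Prop) (t : α) (T : ι → α) : Prop :=
  T r ≤ t ∧ E (T r) T

section Ends

variable {α : Type*} [LinearOrder α] {T : ℤ → α} {t : α} {d s : ℤ} {n : ℕ}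

/-- In the process on the sites `s, …, s + n`, both end sites are vacant at time `t`. -/
def EndsVacant (n : ℕ) (s : ℤ) (t : α) (T : ℤ → α) : Prop :=
  ¬ EndOccupiedUpTo n (ray 1 T s) t ∧ ¬ EndOccupiedUpTo n (ray (-1) T (s + n)) t

/-- In the process on the sites `s, s + 1, …`, the end site `s` is vacant and the site `s + n` is
occupied at time `t`. A site is occupied exactly when it is the occupied end site of the two
processes to its left and to its right. -/
def EndVacantOccupied (n : ℕ) (s : ℤ) (t : α) (T : ℤ → α) : Prop :=
  ¬ EndOccupied (ray 1 T s) t ∧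
    EndOccupiedUpTo n (ray (-1) T (s + n)) t ∧ EndOccupied (ray 1 T (s + n)) t

lemma endOccupiedUpTo_ray_iff_at_arrival :
    EndOccupiedUpTo n (ray d T s) t ↔ T s ≤ t ∧ EndOccupiedUpTo n (ray d T s) (T s) := by
  simpa using endOccupiedUpTo_iff (n := n) (x := ray d T s) (t := t)

lemma endOccupied_ray_iff_at_arrival :
    EndOccupied (ray d T s) t ↔ T s ≤ t ∧ EndOccupied (ray d T s) (T s) := by
  simpa using endOccupied_iff (x := ray d T s) (t := t)

lemma Regular.ray_zero_ne (hT : Regular T) (hd : d ≠ 0) : ray d T s 0 ≠ ray d T s (n + 1) := by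
  refine hT.ne ?_
  have : ((n : ℤ) + 1) * d ≠ 0 := mul_ne_zero (by omega) hd
  push_cast
  omega

lemma Regular.endOccupiedUpTo_right_iff (hT : Regular T) :
    EndOccupiedUpTo n (ray 1 T s) (T (s + n + 1)) ↔
      EndOccupiedUpTo (n + 1) (ray 1 T s) (T (s + n + 1)) := by
  have hray : ray 1 T s (n + 1) = T (s + n + 1) := by simp [ray, add_assoc]
  rw [← hray, endOccupiedUpTo_succ_iff_of_ne (hT.ray_zero_ne one_ne_zero)]

lemma Regular.endOccupiedUpTo_left_iff (hT : Regular T) :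
    EndOccupiedUpTo n (ray (-1) T (s + n + 1)) (T s) ↔
      EndOccupiedUpTo (n + 1) (ray (-1) T (s + n + 1)) (T s) := by
  have hray : ray (-1) T (s + n + 1) (n + 1) = T s := by simp [ray, add_assoc]
  rw [← hray, endOccupiedUpTo_succ_iff_of_ne (hT.ray_zero_ne (neg_ne_zero.2 one_ne_zero))]

lemma Regular.endOccupied_right_iff (hT : Regular T) :
    EndOccupied (ray 1 T s) (T (s + n + 1)) ↔
      EndOccupiedUpTo n (ray 1 T s) (T (s + n + 1)) := by
  have hray : ray 1 T s (n + 1) = T (s + n + 1) := by simp [ray, add_assoc]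
  rw [← hray, endOccupied_iff_upTo_of_ne (hT.ray_zero_ne one_ne_zero)]

lemma Regular.onArrival_endsVacant_left (hT : Regular T) :
    OnArrival s (EndsVacant n (s + 1)) t T ↔
      EndOccupiedUpTo (n + 1) (ray 1 T s) t ∧
        ¬ EndOccupiedUpTo (n + 1) (ray (-1) T (s + n + 1)) (T s) := by
  rw [endOccupiedUpTo_ray_succ, ← hT.endOccupiedUpTo_left_iff, OnArrival, EndsVacant,
    add_right_comm s 1, and_assoc]

lemma Regular.onArrival_endsVacant_right (hT : Regular T) :
    OnArrival (s + n + 1) (EndsVacant n s) t T ↔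
      EndOccupiedUpTo (n + 1) (ray (-1) T (s + n + 1)) t ∧
        ¬ EndOccupiedUpTo (n + 1) (ray 1 T s) (T (s + n + 1)) := by
  rw [endOccupiedUpTo_ray_succ, ← hT.endOccupiedUpTo_right_iff, OnArrival, EndsVacant,
    add_neg_cancel_right, and_assoc, and_comm (a := ¬ EndOccupiedUpTo n (ray 1 T s) _)]

lemma Regular.not_endsVacant_succ_iff (hT : Regular T) :
    ¬ EndsVacant (n + 1) s t T ↔
      OnArrival s (EndsVacant n (s + 1)) t T ∨ OnArrival (s + n + 1) (EndsVacant n s) t T := by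
  rw [hT.onArrival_endsVacant_left, hT.onArrival_endsVacant_right,
    ← or_iff_or_at_arrival (fun _ => endOccupiedUpTo_ray_iff_at_arrival)
      (fun _ => endOccupiedUpTo_ray_iff_at_arrival) (hT.ne (by omega)),
    EndsVacant, Nat.cast_succ, ← add_assoc, ← not_or, not_not]

lemma Regular.not_onArrival_and_onArrival (hT : Regular T) :
    ¬ (OnArrival s (EndsVacant n (s + 1)) t T ∧ OnArrival (s + n + 1) (EndsVacant n s) t T) := by
  rw [hT.onArrival_endsVacant_left, hT.onArrival_endsVacant_right]
  exact not_and_at_arrival (fun _ => endOccupiedUpTo_ray_iff_at_arrival)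
    fun _ => endOccupiedUpTo_ray_iff_at_arrival

lemma Regular.onArrival_and_not_endOccupied_iff (hT : Regular T) :
    OnArrival (s + n + 1)
        (fun u T => EndsVacant n s u T ∧ ¬ EndOccupied (ray 1 T (s + n + 1 + 1)) u) t T ↔
      EndVacantOccupied (n + 1) s t T ∨ OnArrival s (EndVacantOccupied n (s + 1)) t T := by
  have hfirst := and_not_at_arrival_iff (t := t)
    (L := EndOccupied (ray 1 T s))
    (R := fun u => EndOccupiedUpTo (n + 1) (ray (-1) T (s + n + 1)) u ∧
      EndOccupied (ray 1 T (s + n + 1)) u)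
    (fun _ => endOccupied_ray_iff_at_arrival)
    (fun u => by
      rw [endOccupiedUpTo_ray_iff_at_arrival, endOccupied_ray_iff_at_arrival (t := u)]
      tauto)
    (hT.ne (r := s) (s := s + n + 1) (by omega))
  have hright : OnArrival (s + n + 1)
        (fun u T => EndsVacant n s u T ∧ ¬ EndOccupied (ray 1 T (s + n + 1 + 1)) u) t T ↔
      (EndOccupiedUpTo (n + 1) (ray (-1) T (s + n + 1)) t ∧ EndOccupied (ray 1 T (s + n + 1)) t) ∧
        ¬ EndOccupied (ray 1 T s) (T (s + n + 1)) := by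
    rw [endOccupiedUpTo_ray_succ, hT.endOccupied_ray_iff (s := s + n + 1) one_ne_zero,
      hT.endOccupied_right_iff, OnArrival, EndsVacant, add_neg_cancel_right]
    tauto
  have hleft : OnArrival s (EndVacantOccupied n (s + 1)) t T ↔
      EndOccupied (ray 1 T s) t ∧ EndOccupiedUpTo (n + 1) (ray (-1) T (s + n + 1)) (T s) ∧
        EndOccupied (ray 1 T (s + n + 1)) (T s) := by
    rw [hT.endOccupied_ray_iff (s := s) one_ne_zero, ← hT.endOccupiedUpTo_left_iff, OnArrival,
      EndVacantOccupied, add_right_comm s 1, and_assoc]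
  rw [hright, hleft, hfirst, EndVacantOccupied, Nat.cast_succ, ← add_assoc]

lemma Regular.not_endVacantOccupied_and_onArrival (hT : Regular T) :
    ¬ (EndVacantOccupied (n + 1) s t T ∧ OnArrival s (EndVacantOccupied n (s + 1)) t T) :=
  fun h => h.1.1 ((hT.endOccupied_ray_iff one_ne_zero).2 ⟨h.2.1, h.2.2.1⟩)

end Ends

section Shielding

variable {α : Type*} [LinearOrder α] {T : ℤ → α} {t : α} {d s : ℤ}

lemma Regular.not_endOccupied_of_both_vacant (hT : Regular T) (hd : d ≠ 0) (h : T s < T (s + d))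
    (hs : ¬ (EndOccupied (ray d T s) t ∧ EndOccupied (ray (-d) T s) t))
    (hsd : ¬ (EndOccupied (ray d T (s + d)) t ∧ EndOccupied (ray (-d) T (s + d)) t)) :
    ¬ EndOccupied (ray (-d) T s) t ∧ ¬ EndOccupied (ray d T (s + d)) t := by
  have hback : ¬ EndOccupied (ray (-d) T s) t := fun hs' =>
    hs ⟨(endOccupied_ray_iff_of_lt h).2 (by simpa using hs'.arrival_le), hs'⟩
  refine ⟨hback, fun hsd' => hsd ⟨hsd', ?_⟩⟩
  have hle : T (s + d) ≤ t := by simpa using hsd'.arrival_le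
  rw [hT.endOccupied_ray_iff (neg_ne_zero.2 hd), add_neg_cancel_right]
  exact ⟨hle, fun hs' => hback (hs'.mono hle)⟩

/-- A pair of vacant neighbours separates the processes on its two sides. -/
lemma Regular.both_vacant_iff (hT : Regular T) :
    (¬ (EndOccupied (ray 1 T s) t ∧ EndOccupied (ray (-1) T s) t) ∧
        ¬ (EndOccupied (ray 1 T (s + 1)) t ∧ EndOccupied (ray (-1) T (s + 1)) t)) ↔
      ¬ EndOccupied (ray (-1) T s) t ∧ ¬ EndOccupied (ray 1 T (s + 1)) t := by
  refine ⟨fun ⟨h0, h1⟩ => ?_, fun ⟨h0, h1⟩ => ⟨fun h => h0 h.2, fun h => h1 h.1⟩⟩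
  rcases (hT.ne (r := s) (s := s + 1) (by omega)).lt_or_gt with hlt | hgt
  · exact hT.not_endOccupied_of_both_vacant one_ne_zero hlt h0 h1
  · have h := hT.not_endOccupied_of_both_vacant (d := -1) (s := s + 1) (t := t) (by omega)
    simp only [add_neg_cancel_right, neg_neg] at h
    exact (h hgt (fun h => h1 h.symm) fun h => h0 h.symm).symm

end Shielding

lemma Regular.mem_D_iff {T : ℤ → unitInterval} (hT : Regular T) {n : ℕ} {t : unitInterval} :
    T ∈ D n t ↔ ¬ EndOccupied (ray (-1) T (-1)) t ∧ EndVacantOccupied n 0 t T := by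
  have hpair := hT.both_vacant_iff (s := -1) (t := t)
  rw [neg_add_cancel] at hpair
  rw [D, Set.mem_ofPred_eq, ← ne_one_iff_eq_zero, ← ne_one_iff_eq_zero, ne_eq, ne_eq,
    hT.omega_eq_one_iff, hT.omega_eq_one_iff, hT.omega_eq_one_iff, ← and_assoc, hpair, and_assoc,
    EndVacantOccupied, zero_add]
  refine and_congr_right fun hleft => and_congr_right fun _ => ?_
  rw [hT.endOccupied_ray_iff_upTo (n := n) (neg_ne_zero.2 one_ne_zero) (by simpa using hleft),
    and_comm]

section ProductMeasure

variable {ι : Type*} {X : ι → Type*} [∀ i, MeasurableSpace (X i)] {μ : ∀ i, Measure (X i)}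
  [∀ i, IsProbabilityMeasure (μ i)]

lemma measurePreserving_piecewise (S : Set ι) [DecidablePred (· ∈ S)] :
    MeasurePreserving (fun p : (∀ i, X i) × (∀ i, X i) => S.piecewise p.1 p.2)
      ((Measure.infinitePi μ).prod (Measure.infinitePi μ)) (Measure.infinitePi μ) := by
  have hmeas : Measurable fun p : (∀ i, X i) × (∀ i, X i) => S.piecewise p.1 p.2 := by
    refine measurable_pi_lambda _ fun i => ?_
    by_cases hi : i ∈ S
    · simp only [Set.piecewise, hi, if_true]
      fun_prop
    · simp only [Set.piecewise, hi, if_false]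
      fun_prop
  refine ⟨hmeas, Measure.eq_infinitePi _ fun F B hB => ?_⟩
  have hpre : (fun p : (∀ i, X i) × (∀ i, X i) => S.piecewise p.1 p.2) ⁻¹' Set.pi F B =
      Set.pi (F.filter (· ∈ S)) B ×ˢ Set.pi (F.filter (· ∉ S)) B := by
    ext p
    simp only [Set.mem_preimage, Set.mem_pi, Set.mem_prod, Finset.mem_coe, Finset.mem_filter,
      and_imp, ← forall_and]
    refine forall_congr' fun i => ?_
    by_cases hi : i ∈ S <;> simp [hi]
  rw [Measure.map_apply hmeas (.pi F.countable_toSet fun i _ => hB i), hpre, Measure.prod_prod,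
    Measure.infinitePi_pi _ fun i _ => hB i, Measure.infinitePi_pi _ fun i _ => hB i,
    Finset.prod_filter_mul_prod_filter_not]

lemma measurePreserving_update [DecidableEq ι] (r : ι) :
    MeasurePreserving (fun p : X r × (∀ i, X i) => Function.update p.2 r p.1)
      ((μ r).prod (Measure.infinitePi μ)) (Measure.infinitePi μ) := by
  have hmeas : Measurable fun p : X r × (∀ i, X i) => Function.update p.2 r p.1 := by
    rw [measurable_pi_iff]
    intro i
    rcases eq_or_ne i r with rfl | hi
    · simpa using measurable_fst
    · simp only [Function.update_of_ne hi]
      fun_prop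
  have hprod := (measurePreserving_eval_infinitePi μ r).prod
    (MeasurePreserving.id (Measure.infinitePi μ))
  refine ⟨hmeas, Eq.trans ?_ (measurePreserving_piecewise {r}).map_eq⟩
  rw [← hprod.map_eq, Measure.map_map hmeas hprod.measurable]
  congr 1
  funext p i
  rcases eq_or_ne i r with rfl | hi
  · simp
  · simp [hi]

lemma infinitePi_real_and_of_dependsOn {p q : (∀ i, X i) → Prop} (S : Set ι) (hp : Measurable p)
    (hq : Measurable q) (hpS : DependsOn p S) (hqS : DependsOn q Sᶜ) :
    (Measure.infinitePi μ).real {x | p x ∧ q x} =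
      (Measure.infinitePi μ).real {x | p x} * (Measure.infinitePi μ).real {x | q x} := by
  classical
  have hpre : (fun z : (∀ i, X i) × (∀ i, X i) => S.piecewise z.1 z.2) ⁻¹' {x | p x ∧ q x} =
      {x | p x} ×ˢ {x | q x} := by
    ext z
    have hpz : p (S.piecewise z.1 z.2) = p z.1 := hpS fun i hi => S.piecewise_eq_of_mem _ _ hi
    have hqz : q (S.piecewise z.1 z.2) = q z.2 := hqS fun i hi => S.piecewise_eq_of_notMem _ _ hi
    simp only [Set.mem_preimage, Set.mem_ofPred_eq, Set.mem_prod, hpz, hqz]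
  rw [← (measurePreserving_piecewise S).measureReal_preimage
    (measurableSet_setOfPred.2 (hp.and hq)).nullMeasurableSet, hpre, measureReal_prod_prod]

lemma ae_infinitePi_of_ae_update [DecidableEq ι] {p : (∀ i, X i) → Prop} (hp : Measurable p)
    (r : ι) (h : ∀ᵐ u ∂μ r, ∀ᵐ x ∂Measure.infinitePi μ, p (Function.update x r u)) :
    ∀ᵐ x ∂Measure.infinitePi μ, p x := by
  have hset : MeasurableSet {x | p x} := measurableSet_setOfPred.2 hp
  have hupdate := measurePreserving_update (μ := μ) r
  rw [← hupdate.map_eq, ae_map_iff hupdate.measurable.aemeasurable hset]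
  exact (Measure.ae_prod_iff_ae_ae (hupdate.measurable hset)).2 h

end ProductMeasure

section Iid

variable {ι α : Type*} [MeasurableSpace α] {μ : Measure α} [IsProbabilityMeasure μ]

lemma ae_exists_mem_of_injective {A : Set α} (hA : MeasurableSet A) (hμA : μ A ≠ 0) {j : ℕ → ι}
    (hj : Function.Injective j) :
    ∀ᵐ x ∂Measure.infinitePi fun _ : ι => μ, ∃ n, x (j n) ∈ A := by
  have hbound : ∀ N, Measure.infinitePi (fun _ : ι => μ) {x | ∀ n, x (j n) ∉ A} ≤ μ Aᶜ ^ N := by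
    intro N
    calc _ ≤ Measure.infinitePi (fun _ : ι => μ)
          (Set.pi ((Finset.range N).map ⟨j, hj⟩ : Finset ι) fun _ => Aᶜ) := by
          refine measure_mono fun x hx i hi => ?_
          obtain ⟨n, -, rfl⟩ := Finset.mem_map.1 hi
          exact hx n
      _ = μ Aᶜ ^ N := by
          rw [Measure.infinitePi_pi _ fun _ _ => hA.compl, Finset.prod_const, Finset.card_map,
            Finset.card_range]
  have hlt : μ Aᶜ < 1 := prob_le_one.lt_of_ne fun h => hμA ((prob_compl_eq_one_iff hA).1 h)
  rw [ae_iff]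
  simp only [not_exists]
  exact le_antisymm (ge_of_tendsto' (ENNReal.tendsto_pow_atTop_nhds_zero_of_lt_one hlt) hbound)
    zero_le

lemma ae_apply_ne [MeasurableEq α] [NullSingletonClass μ] {i j : ι} (h : i ≠ j) :
    ∀ᵐ x ∂Measure.infinitePi fun _ : ι => μ, x i ≠ x j := by
  classical
  refine ae_infinitePi_of_ae_update (by fun_prop) i (.of_forall fun u => ?_)
  have hu : ∀ᵐ a ∂μ, u ≠ a := by simp [ae_iff]
  simpa [h.symm] using
    (measurePreserving_eval_infinitePi (fun _ : ι => μ) j).quasiMeasurePreserving.ae hu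

variable [Preorder α] [TopologicalSpace α] [ClosedIicTopology α] [OpensMeasurableSpace α] {r : ι}
  {E : α → (ι → α) → Prop}

lemma measurable_onArrival (hE : Measurable fun p : α × (ι → α) => E p.1 p.2) (t : α) :
    Measurable (OnArrival r E t) :=
  (measurableSet_setOfPred.1 (measurableSet_Iic.preimage (measurable_pi_apply r))).and
    (hE.comp (f := fun T : ι → α => (T r, T)) (by fun_prop))

lemma infinitePi_onArrival (hE : Measurable fun p : α × (ι → α) => E p.1 p.2)
    (hEr : ∀ u, DependsOn (E u) {r}ᶜ) (t : α) :
    Measure.infinitePi (fun _ => μ) {T | OnArrival r E t T} =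
      ∫⁻ u in Set.Iic t, Measure.infinitePi (fun _ => μ) {T | E u T} ∂μ := by
  classical
  have hA : MeasurableSet {T : ι → α | OnArrival r E t T} :=
    measurableSet_setOfPred.2 (measurable_onArrival hE t)
  have hupdate := measurePreserving_update (μ := fun _ : ι => μ) r
  rw [← hupdate.measure_preimage hA.nullMeasurableSet,
    Measure.prod_apply (hupdate.measurable hA), ← lintegral_indicator measurableSet_Iic]
  refine lintegral_congr fun u => ?_
  have hEu : ∀ T : ι → α, E u (Function.update T r u) = E u T := fun T =>
    hEr u fun i hi => Function.update_of_ne hi _ _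
  by_cases hu : u ≤ t <;> simp [OnArrival, hu, hEu]

end Iid

section Events

@[fun_prop]
lemma measurable_ray {Ω α : Type*} [MeasurableSpace Ω] [MeasurableSpace α] {d s : ℤ}
    {T : Ω → ℤ → α} (hT : Measurable T) : Measurable fun ω => ray d (T ω) s := by
  unfold ray
  fun_prop

variable {α : Type*} [LinearOrder α] {t : α} {d s : ℤ} {n : ℕ} {S : Set ℤ}

lemma dependsOn_endOccupiedUpTo_ray (h : ∀ i : ℕ, i ≤ n → s + i * d ∈ S) (t : α) :
    DependsOn (fun T : ℤ → α => EndOccupiedUpTo n (ray d T s) t) S :=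
  fun _ _ hT => propext (endOccupiedUpTo_congr fun i hi => hT _ (h i hi))

lemma dependsOn_endOccupied_ray (h : ∀ i : ℕ, s + i * d ∈ S) (t : α) :
    DependsOn (fun T : ℤ → α => EndOccupied (ray d T s) t) S :=
  fun _ _ hT => congrArg (EndOccupied · t) (funext fun i => hT _ (h i))

lemma dependsOn_endsVacant : DependsOn (EndsVacant n s t) (Set.Icc s (s + n)) := fun _ _ hT =>
  congrArg₂ (¬ · ∧ ¬ ·)
    (dependsOn_endOccupiedUpTo_ray (fun i hi => Set.mem_Icc.2 (by omega)) t hT)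
    (dependsOn_endOccupiedUpTo_ray (fun i hi => Set.mem_Icc.2 (by omega)) t hT)

lemma dependsOn_endVacantOccupied : DependsOn (EndVacantOccupied n s t) (Set.Ici s) :=
  fun _ _ hT => congrArg₂ (¬ · ∧ ·)
    (dependsOn_endOccupied_ray (fun i => Set.mem_Ici.2 (by omega)) t hT)
    (congrArg₂ And
      (dependsOn_endOccupiedUpTo_ray (fun i hi => Set.mem_Ici.2 (by omega)) t hT)
      (dependsOn_endOccupied_ray (fun i => Set.mem_Ici.2 (by omega)) t hT))

variable {Ω : Type*} [MeasurableSpace Ω] [MeasurableSpace α] [TopologicalSpace α]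
  [OrderClosedTopology α] [SecondCountableTopology α] [OpensMeasurableSpace α]

@[fun_prop]
lemma measurable_endOccupiedUpTo {x : Ω → ℕ → α} {t : Ω → α} (hx : Measurable x)
    (ht : Measurable t) : Measurable fun ω => EndOccupiedUpTo n (x ω) (t ω) := by
  induction n generalizing x t with
  | zero =>
    simp only [EndOccupiedUpTo]
    fun_prop
  | succ n ih =>
    simp only [EndOccupiedUpTo]
    fun_prop

@[fun_prop]
lemma measurable_endOccupied {x : Ω → ℕ → α} {t : Ω → α} (hx : Measurable x)
    (ht : Measurable t) : Measurable fun ω => EndOccupied (x ω) (t ω) := by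
  simp only [EndOccupied, eventually_atTop]
  fun_prop

@[fun_prop]
lemma measurable_endsVacant {T : Ω → ℤ → α} {t : Ω → α} (hT : Measurable T)
    (ht : Measurable t) : Measurable fun ω => EndsVacant n s (t ω) (T ω) := by
  unfold EndsVacant
  fun_prop

@[fun_prop]
lemma measurable_endVacantOccupied {T : Ω → ℤ → α} {t : Ω → α} (hT : Measurable T)
    (ht : Measurable t) : Measurable fun ω => EndVacantOccupied n s (t ω) (T ω) := by
  unfold EndVacantOccupied
  fun_prop

end Events

section Regularity

instance : IsProbabilityMeasure P := inferInstanceAs (IsProbabilityMeasure (Measure.infinitePi _))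

lemma ae_exists_lt_ray {d : ℤ} (hd : d ≠ 0) (s : ℤ) :
    ∀ᵐ T ∂P, ∃ n, T s < ray d T s (n + 1) := by
  have hne : ∀ n : ℕ, s + (n + 1 : ℕ) * d ≠ s := fun n => by
    simpa using ⟨n.cast_add_one_ne_zero, hd⟩
  have hinj : Function.Injective fun n : ℕ => s + (n + 1 : ℕ) * d := fun m n hmn => by
    simpa [hd] using hmn
  refine ae_infinitePi_of_ae_update (by fun_prop) s ?_
  filter_upwards [compl_mem_ae_iff.2 (measure_singleton (1 : unitInterval))] with u hu
  have hIoi : volume (Set.Ioi u) ≠ 0 := by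
    simpa using lt_of_le_of_ne unitInterval.le_one' hu
  simpa only [ray, Function.update_self, Function.update_of_ne (hne _), Set.mem_Ioi] using
    ae_exists_mem_of_injective measurableSet_Ioi hIoi hinj

lemma ae_regular : ∀ᵐ T ∂P, Regular T := by
  have hne : ∀ᵐ T ∂P, ∀ i j : ℤ, i ≠ j → T i ≠ T j := by
    simp only [ae_all_iff]
    exact fun i j h => ae_apply_ne h
  have hlt : ∀ᵐ T ∂P, ∀ d : ℤ, d ≠ 0 → ∀ s, ∃ n, T s < ray d T s (n + 1) := by
    simp only [ae_all_iff]
    exact fun d hd s => ae_exists_lt_ray hd s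
  filter_upwards [hne, hlt] with T hne hlt
  exact ⟨fun i j h => by_contra fun hij => hne i j hij h, hlt⟩

end Regularity

section ConditioningOnArrival

variable {Ω : Type*} [MeasurableSpace Ω] {μ : Measure Ω} {p q r : Ω → Prop}

lemma probReal_setOf_not [IsProbabilityMeasure μ] (hp : Measurable p) :
    μ.real {x | ¬ p x} = 1 - μ.real {x | p x} :=
  probReal_compl_eq_one_sub (measurableSet_setOfPred.2 hp)

lemma measureReal_eq_add_of_ae [IsFiniteMeasure μ] (hr : Measurable r)
    (h : ∀ᵐ x ∂μ, p x ↔ q x ∨ r x) (hqr : ∀ᵐ x ∂μ, ¬ (q x ∧ r x)) :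
    μ.real {x | p x} = μ.real {x | q x} + μ.real {x | r x} := by
  rw [← measureReal_union₀ (measurableSet_setOfPred.2 hr).nullMeasurableSet]
  · exact measureReal_congr (h.mono fun x hx => propext hx)
  · exact measure_mono_null (fun x hx => not_not.2 hx) hqr

lemma setIntegral_unitInterval_Iic {V : Type*} [NormedAddCommGroup V] [NormedSpace ℝ V]
    (f : ℝ → V) (t : unitInterval) :
    ∫ u : unitInterval in Set.Iic t, f u = ∫ u in (0 : ℝ)..t, f u := by
  have hIcc : Set.Iic (t : ℝ) ∩ unitInterval = Set.Icc 0 (t : ℝ) := by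
    ext x
    simp only [Set.mem_inter_iff, Set.mem_Iic, Set.mem_Icc]
    exact ⟨fun h => ⟨h.2.1, h.1⟩, fun h => ⟨h.2, h.1, h.2.trans t.2.2⟩⟩
  rw [intervalIntegral.integral_of_le t.2.1, ← integral_Icc_eq_integral_Ioc, ← hIcc,
    ← Measure.restrict_restrict measurableSet_Iic,
    ← unitInterval.measurePreserving_coe.setIntegral_preimage_emb
      unitInterval.measurableEmbedding_coe]
  rfl

/-- Conditioning on the arrival time of `r`, which is independent of `E u`. -/
lemma real_onArrival {r : ℤ} {E : unitInterval → (ℤ → unitInterval) → Prop} {f : ℝ → ℝ}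
    (hE : Measurable fun p : unitInterval × (ℤ → unitInterval) => E p.1 p.2)
    (hEr : ∀ u, DependsOn (E u) {r}ᶜ) (hf : ∀ u : unitInterval, P.real {T | E u T} = f u)
    (t : unitInterval) : P.real {T | OnArrival r E t T} = ∫ u in (0 : ℝ)..t, f u := by
  have hmeas : Measurable fun u => P {T | E u T} :=
    measurable_measure_prodMk_left (measurableSet_setOfPred.2 hE)
  simp only [← setIntegral_unitInterval_Iic, ← hf, measureReal_def]
  rw [integral_toReal hmeas.aemeasurable (.of_forall fun u => measure_lt_top P _)]
  exact congrArg ENNReal.toReal (infinitePi_onArrival hE hEr t)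

end ConditioningOnArrival

section PartialExponentialSums

/-- The sum of the first `n` terms of the exponential series, in which the probabilities of the
events above are expressed. -/
noncomputable def expSum (n : ℕ) (x : ℝ) : ℝ :=
  ∑ i ∈ Finset.range n, x ^ i / (Nat.factorial i : ℝ)

lemma expSum_succ (n : ℕ) (x : ℝ) :
    expSum (n + 1) x = expSum n x + x ^ n / (Nat.factorial n : ℝ) :=
  Finset.sum_range_succ _ _

lemma expSum_one (x : ℝ) : expSum 1 x = 1 := by simp [expSum]

lemma expSum_two (x : ℝ) : expSum 2 x = 1 + x := by simp [expSum, Finset.sum_range_succ]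

lemma expSum_succ_zero (n : ℕ) : expSum (n + 1) 0 = 1 := by
  simp [expSum, Finset.sum_range_succ']

lemma expSum_succ_sub_one (n : ℕ) (x : ℝ) :
    expSum (n + 1) x - 1 = ∑ i ∈ Finset.Icc 1 n, x ^ i / (Nat.factorial i : ℝ) := by
  rw [expSum, Finset.sum_range_eq_add_Ico _ n.succ_pos, ← Finset.Ico_add_one_right_eq_Icc]
  simp

@[fun_prop]
lemma continuous_expSum (n : ℕ) : Continuous (expSum n) := by
  unfold expSum
  fun_prop

lemma tendsto_expSum (x : ℝ) : Tendsto (fun n => expSum n x) atTop (𝓝 (Real.exp x)) := by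
  rw [Real.exp_eq_exp_ℝ]
  exact (NormedSpace.expSeries_div_hasSum_exp x).tendsto_sum_nat

lemma hasDerivAt_expSum_succ (n : ℕ) (x : ℝ) :
    HasDerivAt (expSum (n + 1)) (expSum n x) x := by
  induction n with
  | zero =>
    rw [show expSum (0 + 1) = _ from funext expSum_one]
    simpa [expSum] using hasDerivAt_const x (1 : ℝ)
  | succ n ih =>
    rw [show expSum (n + 1 + 1) = _ from funext (expSum_succ (n + 1)), expSum_succ n]
    refine ih.add (((hasDerivAt_pow (n + 1) x).div_const _).congr_deriv ?_)
    rw [Nat.factorial_succ]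
    push_cast
    field_simp

lemma hasDerivAt_expSum_succ_const_mul (n : ℕ) (c x : ℝ) :
    HasDerivAt (fun y => expSum (n + 1) (c * y)) (c * expSum n (c * x)) x :=
  ((hasDerivAt_expSum_succ n (c * x)).comp x (hasDerivAt_const_mul c)).congr_deriv (mul_comm _ _)

lemma integral_expSum_const_mul (n : ℕ) {c : ℝ} (hc : c ≠ 0) (t : ℝ) :
    ∫ u in (0 : ℝ)..t, expSum n (c * u) = (expSum (n + 1) (c * t) - 1) / c := by
  rw [intervalIntegral.integral_comp_mul_left _ hc, mul_zero,
    intervalIntegral.integral_eq_sub_of_hasDerivAt (fun x _ => hasDerivAt_expSum_succ n x)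
      ((continuous_expSum n).intervalIntegrable _ _), expSum_succ_zero, smul_eq_mul]
  ring

end PartialExponentialSums

section Probabilities

variable {d : ℤ}

lemma real_arrival_le (s : ℤ) (t : unitInterval) : P.real {T | T s ≤ t} = t := by
  have h := (measurePreserving_eval_infinitePi (fun _ : ℤ => (volume : Measure unitInterval))
    s).measureReal_preimage (s := Set.Iic t) measurableSet_Iic.nullMeasurableSet
  exact h.trans (by simp [measureReal_def, t.2.1])

lemma real_not_endOccupiedUpTo (hd : d ≠ 0) (n : ℕ) (s : ℤ) (t : unitInterval) :
    P.real {T | ¬ EndOccupiedUpTo n (ray d T s) t} = expSum (n + 2) (-t) := by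
  rw [probReal_setOf_not (by fun_prop)]
  induction n generalizing s t with
  | zero =>
    simp only [EndOccupiedUpTo, ray_apply_zero, real_arrival_le, zero_add, expSum_two]
    ring
  | succ n ih =>
    have hE : ∀ u : unitInterval, DependsOn
        (fun T => ¬ EndOccupiedUpTo n (ray d T (s + d)) u) {s}ᶜ := fun u T T' h =>
      congrArg Not (dependsOn_endOccupiedUpTo_ray (fun i _ => by
        have : ((i : ℤ) + 1) * d ≠ 0 := mul_ne_zero (by omega) hd
        simp only [Set.mem_compl_iff, Set.mem_singleton_iff]
        grind) u h)
    have hrec := real_onArrival (f := fun x => expSum (n + 2) (-x)) (by fun_prop) hE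
      (fun u => (probReal_setOf_not (by fun_prop)).trans (ih (s + d) u)) t
    simp only [OnArrival, ← endOccupiedUpTo_ray_succ] at hrec
    have hintegral := integral_expSum_const_mul (n + 2) (neg_ne_zero.2 one_ne_zero) (t : ℝ)
    simp only [neg_one_mul] at hintegral
    rw [hrec, hintegral]
    ring

lemma real_not_endOccupied (hd : d ≠ 0) (s : ℤ) (t : unitInterval) :
    P.real {T | ¬ EndOccupied (ray d T s) t} = Real.exp (-t) := by
  have hlim : Tendsto (fun n => P.real {T | ¬ EndOccupiedUpTo n (ray d T s) t}) atTop
      (𝓝 (P.real {T | ¬ EndOccupied (ray d T s) t})) := by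
    refine (ENNReal.tendsto_toReal (measure_ne_top _ _)).comp
      (tendsto_measure_of_ae_tendsto_indicator_of_isFiniteMeasure atTop
        (measurableSet_setOfPred.2 (by fun_prop))
        (fun n => measurableSet_setOfPred.2 (by fun_prop)) ?_)
    filter_upwards [ae_exists_lt_ray hd s] with T hT
    exact (eventually_endOccupiedUpTo_iff (by simpa using hT) t).mono fun n hn => not_congr hn
  simp only [real_not_endOccupiedUpTo hd] at hlim
  exact tendsto_nhds_unique hlim ((tendsto_expSum _).comp (tendsto_add_atTop_nat 2))

lemma real_endsVacant (n : ℕ) (s : ℤ) (t : unitInterval) :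
    P.real {T | EndsVacant n s t T} = (expSum (n + 1) (-2 * t) + expSum (n + 2) (-2 * t)) / 2 := by
  induction n generalizing s t with
  | zero =>
    have hsingle : ∀ T : ℤ → unitInterval, EndsVacant 0 s t T ↔ ¬ T s ≤ t := by
      simp [EndsVacant, EndOccupiedUpTo]
    simp only [hsingle, probReal_setOf_not (p := fun T : ℤ → unitInterval => T s ≤ t) (by fun_prop),
      real_arrival_le, zero_add, expSum_one, expSum_two]
    ring
  | succ n ih =>
    have honArrival : ∀ r s : ℤ, r ∉ Set.Icc s (s + n) →
        P.real {T | OnArrival r (EndsVacant n s) t T} =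
          ∫ u in (0 : ℝ)..t, (expSum (n + 1) (-2 * u) + expSum (n + 2) (-2 * u)) / 2 :=
      fun r s hr => real_onArrival
        (f := fun x => (expSum (n + 1) (-2 * x) + expSum (n + 2) (-2 * x)) / 2) (by fun_prop)
        (fun u => dependsOn_endsVacant.mono (Set.subset_compl_singleton_iff.2 hr)) (ih s) t
    have hsplit := measureReal_eq_add_of_ae (measurable_onArrival (by fun_prop) t)
      (ae_regular.mono fun T hT => hT.not_endsVacant_succ_iff (n := n) (s := s) (t := t))
      (ae_regular.mono fun T hT => hT.not_onArrival_and_onArrival)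
    rw [probReal_setOf_not (by fun_prop), honArrival _ _ (by simp), honArrival _ _ (by simp),
      intervalIntegral.integral_div, intervalIntegral.integral_add
        (Continuous.intervalIntegrable (by fun_prop) _ _)
        (Continuous.intervalIntegrable (by fun_prop) _ _),
      integral_expSum_const_mul _ (by norm_num), integral_expSum_const_mul _ (by norm_num)]
      at hsplit
    linarith

lemma real_endsVacant_and_not_endOccupied (n : ℕ) (s : ℤ) (t : unitInterval) :
    P.real {T | EndsVacant n s t T ∧ ¬ EndOccupied (ray 1 T (s + n + 1 + 1)) t} =
      (expSum (n + 1) (-2 * t) + expSum (n + 2) (-2 * t)) / 2 * Real.exp (-t) := by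
  rw [← real_endsVacant n s, ← real_not_endOccupied one_ne_zero (s + n + 1 + 1)]
  exact infinitePi_real_and_of_dependsOn (Set.Iic (s + n)) (by fun_prop) (by fun_prop)
    (dependsOn_endsVacant.mono Set.Icc_subset_Iic_self)
    fun T T' h => congrArg Not (dependsOn_endOccupied_ray
      (fun i => by simp only [Set.mem_compl_iff, Set.mem_Iic]; omega) t h)

lemma hasDerivAt_exp_neg_mul_expSum (n : ℕ) (x : ℝ) :
    HasDerivAt (fun y => -(1 / 2) * Real.exp (-y) * (expSum (n + 2) (-2 * y) - 1))
      ((expSum (n + 1) (-2 * x) + expSum (n + 2) (-2 * x)) / 2 * Real.exp (-x) -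
        -(1 / 2) * Real.exp (-x) * (expSum (n + 1) (-2 * x) - 1)) x :=
  (((hasDerivAt_neg x).exp.const_mul (-(1 / 2))).mul
    ((hasDerivAt_expSum_succ_const_mul (n + 1) (-2) x).sub_const 1)).congr_deriv (by ring)

lemma real_endVacantOccupied (n : ℕ) (s : ℤ) (t : unitInterval) :
    P.real {T | EndVacantOccupied n s t T} =
      -(1 / 2) * Real.exp (-t) * (expSum (n + 1) (-2 * t) - 1) := by
  induction n generalizing s t with
  | zero =>
    have hfalse : ∀ T, ¬ EndVacantOccupied 0 s t T := fun T h => h.1 (by simpa using h.2.2)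
    simp [hfalse, expSum_one]
  | succ n ih =>
    have hright := real_onArrival (r := s + n + 1)
      (E := fun u T => EndsVacant n s u T ∧ ¬ EndOccupied (ray 1 T (s + n + 1 + 1)) u)
      (f := fun x => (expSum (n + 1) (-2 * x) + expSum (n + 2) (-2 * x)) / 2 * Real.exp (-x))
      (by fun_prop)
      (fun u T T' h => congrArg₂ (· ∧ ¬ ·) (dependsOn_endsVacant.mono (by simp) h)
        (dependsOn_endOccupied_ray (fun i => by
          simp only [Set.mem_compl_iff, Set.mem_singleton_iff]; omega) u h))
      (real_endsVacant_and_not_endOccupied n s) t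
    have hleft := real_onArrival (r := s) (E := EndVacantOccupied n (s + 1))
      (f := fun x => -(1 / 2) * Real.exp (-x) * (expSum (n + 1) (-2 * x) - 1)) (by fun_prop)
      (fun u => dependsOn_endVacantOccupied.mono (by simp)) (ih (s + 1)) t
    have hsplit := measureReal_eq_add_of_ae (measurable_onArrival (by fun_prop) t)
      (ae_regular.mono fun T hT => hT.onArrival_and_not_endOccupied_iff (n := n) (s := s) (t := t))
      (ae_regular.mono fun T hT => hT.not_endVacantOccupied_and_onArrival)
    rw [hright, hleft] at hsplit
    rw [← sub_eq_iff_eq_add.2 hsplit, ← intervalIntegral.integral_sub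
      (Continuous.intervalIntegrable (by fun_prop) _ _)
      (Continuous.intervalIntegrable (by fun_prop) _ _),
      intervalIntegral.integral_eq_sub_of_hasDerivAt
        (fun x _ => hasDerivAt_exp_neg_mul_expSum n x)
        (Continuous.intervalIntegrable (by fun_prop) _ _)]
    simp [expSum_succ_zero]

end Probabilities

section Density

variable (n : ℕ) (t : unitInterval)

lemma ae_eq_D :
    {T | ¬ EndOccupied (ray (-1) T (-1)) t ∧ EndVacantOccupied n 0 t T} =ᵐ[P] D n t :=
  ae_regular.mono fun _ hT => propext hT.mem_D_iff.symm

lemma nullMeasurableSet_D : NullMeasurableSet (D n t) P :=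
  (measurableSet_setOfPred.2 (by fun_prop)).nullMeasurableSet.congr (ae_eq_D n t)

lemma gamma_eq :
    gamma n t = Real.exp (-t) * (-(1 / 2) * Real.exp (-t) * (expSum (n + 1) (-2 * t) - 1)) := by
  rw [gamma, ← measureReal_congr (ae_eq_D n t), ← real_endVacantOccupied n 0,
    ← real_not_endOccupied (neg_ne_zero.2 one_ne_zero) (-1)]
  exact infinitePi_real_and_of_dependsOn (Set.Iic (-1)) (by fun_prop) (by fun_prop)
    (fun T T' h => congrArg Not (dependsOn_endOccupied_ray
      (fun i => by simp only [Set.mem_Iic]; omega) t h))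
    (dependsOn_endVacantOccupied.mono fun i hi => by
      simp only [Set.mem_Ici, Set.mem_compl_iff, Set.mem_Iic] at hi ⊢; omega)

end Density

end RSA

theorem proposition1_general :
    (∀ᵐ T ∂(RSA.P), ∃! ω : RSA.Evolution, RSA.IsEvolution T ω) ∧
    ∀ (t : unitInterval) (s : ℕ),
      NullMeasurableSet (RSA.D (s : ℤ) t) RSA.P ∧
      RSA.gamma (s : ℤ) t =
        -(1 / 2 : ℝ) * Real.exp (-2 * (t : ℝ)) *
          ∑ i ∈ Finset.Icc 1 s, (-2 * (t : ℝ)) ^ i / (Nat.factorial i : ℝ) := by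
  refine ⟨RSA.ae_regular.mono fun T hT => hT.existsUnique_isEvolution,
    fun t s => ⟨RSA.nullMeasurableSet_D s t, ?_⟩⟩
  have hexp : Real.exp (-2 * (t : ℝ)) = Real.exp (-t) * Real.exp (-t) := by
    rw [← Real.exp_add]
    ring_nf
  rw [RSA.gamma_eq, RSA.expSum_succ_sub_one, hexp]
  ring

theorem proposition1 :
    (∀ᵐ T ∂(RSA.P), ∃! ω : RSA.Evolution, RSA.IsEvolution T ω) ∧
    ∀ (t : unitInterval) (s : ℕ), Even s →
      NullMeasurableSet (RSA.D (s : ℤ) t) RSA.P ∧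
      RSA.gamma (s : ℤ) t =
        -(1 / 2 : ℝ) * Real.exp (-2 * (t : ℝ)) *
          ∑ i ∈ Finset.Icc 1 s, (-2 * (t : ℝ)) ^ i / (Nat.factorial i : ℝ) :=
  ⟨proposition1_general.1, fun t s _ => proposition1_general.2 t s⟩
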